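/- Let $\mathbb{K}$ be a field and let $R=\mathbb{K}[x_1,\ldots,x_n]$ be the standard graded polynomial ring. For a homogeneous ideal $I\subseteq R$, let $0\to F_p\to\cdots\to F_1\to F_0\to R/I\to 0$ be the minimal graded free resolution of $R/I$, with $F_i=\bigoplus_j R(-j)^{\beta_{i,j}}$, and put $t_i^R(R/I)=\sup\{j : \beta_{i,j}\neq 0\}$ (with $\sup\emptyset=-\infty$). We say that subadditivity holds for $R/I$ if $t_{a+b}^R(R/I)\le t_a^R(R/I)+t_b^R(R/I)$ for all $a,b\ge 0$ with $a+b\le p$. Theorem. Let $I,J$ be homogeneous ideals of $R$ such that there exist minimal generating sets of $I$ and of $J$ in disjoint sets of variables; that is, there are disjoint subsets $A,B\subseteq\{x_1,\ldots,x_n\}$, a minimal generating set of $I$ all of whose elements lie in $\mathbb{K}[A]$, and a minimal generating set of $J$ all of whose elements lie in $\mathbb{K}[B]$. If subadditivity holds for $R/I$ and for $R/J$, then subadditivity holds for $R/(I+J)$. -/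

import Mathlib

attribute [local instance] MvPolynomial.gradedAlgebra

/-- The degree-`z` part of the standard graded polynomial ring, with `z` an integer
(zero for negative `z`). -/
noncomputable def polyDegreePart (σ K : Type*) [Field K] : ℤ → Submodule K (MvPolynomial σ K)
  | Int.ofNat m => MvPolynomial.homogeneousSubmodule σ K m
  | Int.negSucc _ => ⊥

/-- The degree-`j` part of the graded free module `⨁ₖ R(-d k)`, where `R = K[σ]`: the basis
vector with index `k` has degree `d k`. -/
noncomputable def freeDegreePart {σ K : Type*} [Field K] {κ : Type*} (d : κ → ℤ) (j : ℤ) :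
    Submodule K (κ → MvPolynomial σ K) where
  carrier := {v | ∀ k, v k ∈ polyDegreePart σ K (j - d k)}
  add_mem' hv hw k := Submodule.add_mem _ (hv k) (hw k)
  zero_mem' _ := Submodule.zero_mem _
  smul_mem' c _ hv k := Submodule.smul_mem _ c (hv k)

/-- The degree-`j` part of `R ⧸ I`: the classes of the homogeneous polynomials of degree `j`. -/
noncomputable def quotientDegreePart {σ K : Type*} [Field K] (I : Ideal (MvPolynomial σ K)) (j : ℤ) :
    Submodule K (MvPolynomial σ K ⧸ I) :=
  (polyDegreePart σ K j).map (Ideal.Quotient.mkₐ K I).toLinearMap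

/-- A graded free resolution (not necessarily minimal), of finite length and by free modules of
finite rank, of a module `M` over `R = K[σ]` with graded pieces `ℳ j`:
`0 → F p → ⋯ → F 1 → F 0 → M → 0`, where `F i = ⨁ₖ R(-deg i k)` and `p = length`.
Here `F i = 0` for `i > p`, so that exactness at `F p` is injectivity of `F p → F (p - 1)`. -/
structure GradedFreeResolution (σ : Type*) {K : Type*} [Field K] {M : Type*} [AddCommGroup M]
    [Module (MvPolynomial σ K) M] [Module K M] (ℳ : ℤ → Submodule K M) where
  /-- the index type of the homogeneous basis of `F i` -/
  ι : ℕ → Type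
  [fintype_ι : ∀ i, Fintype (ι i)]
  /-- the degrees of the basis elements -/
  deg : ∀ i, ι i → ℤ
  length : ℕ
  isEmpty_of_length_lt : ∀ i, length < i → IsEmpty (ι i)
  /-- the differential `F (i + 1) → F i` -/
  diff : ∀ i, (ι (i + 1) → MvPolynomial σ K) →ₗ[MvPolynomial σ K] (ι i → MvPolynomial σ K)
  /-- the augmentation `F 0 → M` -/
  aug : (ι 0 → MvPolynomial σ K) →ₗ[MvPolynomial σ K] M
  diff_mem : ∀ i j, ∀ v ∈ freeDegreePart (deg (i + 1)) j, diff i v ∈ freeDegreePart (deg i) j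
  aug_mem : ∀ j, ∀ v ∈ freeDegreePart (deg 0) j, aug v ∈ ℳ j
  aug_surjective : Function.Surjective aug
  exact_zero : Function.Exact (diff 0) aug
  exact_succ : ∀ i, Function.Exact (diff (i + 1)) (diff i)

namespace GradedFreeResolution

variable {σ K : Type*} [Field K] {M : Type*} [AddCommGroup M]
  [Module (MvPolynomial σ K) M] [Module K M] {ℳ : ℤ → Submodule K M}

/-- Minimality: the image of `F (i + 1)` lies in `𝔪 F i`, where `𝔪` is the ideal generated by the
variables. -/
def IsMinimal (F : GradedFreeResolution σ ℳ) : Prop :=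
  ∀ i v k, F.diff i v k ∈ Ideal.span (Set.range (MvPolynomial.X : σ → MvPolynomial σ K))

/-- The maximal shift `t i = sup {j | R(-j) is a summand of F i}`, which is `⊥` (that is, `-∞`)
if `F i = 0`. -/
noncomputable def t (F : GradedFreeResolution σ ℳ) (i : ℕ) : WithBot ℤ :=
  letI := F.fintype_ι i
  Finset.univ.sup fun k : F.ι i => (F.deg i k : WithBot ℤ)

/-- Subadditivity of the maximal shifts of a graded free resolution. -/
def Subadditive (F : GradedFreeResolution σ ℳ) : Prop :=
  ∀ a b : ℕ, a + b ≤ F.length → F.t (a + b) ≤ F.t a + F.t b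

end GradedFreeResolution

/-- Subadditivity holds for `R ⧸ I`: the minimal graded free resolution of `R ⧸ I` (it exists, and
is unique up to isomorphism) is subadditive. -/
def SubadditivityHolds {σ K : Type*} [Field K] (I : Ideal (MvPolynomial σ K)) : Prop :=
  (∃ F : GradedFreeResolution σ (quotientDegreePart I), F.IsMinimal) ∧
    ∀ F : GradedFreeResolution σ (quotientDegreePart I), F.IsMinimal → F.Subadditive

/-! ### Lifting, null-homotopies and contractions. -/

section Homotopy

/-! If `F` and `G` minimally resolve `R/I` and `R/J`, then `F ⊗ G` minimally resolves `R/(I+J)`.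
Hence `t_c(R/(I+J))` is the maximum of `t_i(R/I) + t_j(R/J)` over `i + j = c`. Given `i + j = a +
b`, split `i = i₁ + i₂` and `j = j₁ + j₂` with `i₁ + j₁ = a` and `i₂ + j₂ = b`; subadditivity for
`I` and `J` then gives it for `I + J` (`Subadditive.tensor`).

The substance is the acyclicity of `F ⊗ G` (`exists_tensor`), that is, `Tor_i(R/I, R/J) = 0` for `i
> 0`. Since `J` is extended from `K[B]`, both `R` and `R/J` are projective over `K[Bᶜ]`, so the
augmented complex `G → R/J` has a `K[Bᶜ]`-linear contraction. As `I` is generated by elements of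
`K[A] ⊆ K[Bᶜ]`, the contraction preserves vectors with entries in `I`, so `G ⊗ R/I` stays exact
(`exists_sub_diff_mem`). Exactness of the total complex follows by clearing the components of a
cycle one at a time (`exists_diff_eq`).

Subadditivity is required of every minimal resolution, so the shifts must not depend on the choice;
`IsMinimal.t_le` proves this by comparing resolutions. -/

theorem Module.Projective.exists_lift_of_mem_range {T P M N : Type*} [Ring T] [AddCommGroup P]
    [AddCommGroup M] [AddCommGroup N] [Module T P] [Module T M] [Module T N]
    [Module.Projective T P] (g : M →ₗ[T] N) (f : P →ₗ[T] N)
    (hf : ∀ x, f x ∈ LinearMap.range g) : ∃ h : P →ₗ[T] M, ∀ x, g (h x) = f x := by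
  obtain ⟨h, hh⟩ := Module.projective_lifting_property g.rangeRestrict
    (f.codRestrict (LinearMap.range g) hf) g.surjective_rangeRestrict
  exact ⟨h, fun x => congrArg Subtype.val (LinearMap.congr_fun hh x)⟩

/-- A chain map from a complex of projectives to an exact complex which is null-homotopic at the
start is null-homotopic. -/
theorem exists_nullHomotopy {T : Type*} [Ring T] {C D : ℕ → Type*}
    [∀ i, AddCommGroup (C i)] [∀ i, Module T (C i)] [∀ i, AddCommGroup (D i)]
    [∀ i, Module T (D i)] [∀ i, Module.Projective T (C i)]
    (dC : ∀ i, C (i + 1) →ₗ[T] C i) (dD : ∀ i, D (i + 1) →ₗ[T] D i)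
    (hC : ∀ i x, dC i (dC (i + 1) x) = 0)
    (hD : ∀ i, Function.Exact (dD (i + 1)) (dD i))
    (θ : ∀ i, C i →ₗ[T] D i) (hθ : ∀ i x, dD i (θ (i + 1) x) = θ i (dC i x))
    (h₀ : C 0 →ₗ[T] D 1) (hh₀ : ∀ x, dD 0 (h₀ (dC 0 x)) = θ 0 (dC 0 x)) :
    ∃ h : ∀ i, C i →ₗ[T] D (i + 1), h 0 = h₀ ∧
      ∀ i x, dD (i + 1) (h (i + 1) x) + h i (dC i x) = θ (i + 1) x := by
  have step : ∀ i (h : C i →ₗ[T] D (i + 1)), (∀ x, dD i (h (dC i x)) = θ i (dC i x)) →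
      ∃ h' : C (i + 1) →ₗ[T] D (i + 2), ∀ x, dD (i + 1) (h' x) = (θ (i + 1) - h ∘ₗ dC i) x := by
    intro i h hh
    refine Module.Projective.exists_lift_of_mem_range _ _ fun x => ?_
    rw [LinearMap.mem_range, ← Set.mem_range, ← hD i]
    simp [hθ, hh]
  -- The recursion carries the condition that `θ - h ∘ dC` lands in the kernel of `dD`, without
  -- which the next lift need not exist.
  let Q : ℕ → Type _ := fun i =>
    {h : C i →ₗ[T] D (i + 1) // ∀ x, dD i (h (dC i x)) = θ i (dC i x)}
  let next : ∀ i, Q i → Q (i + 1) := fun i h => ⟨(step i h.1 h.2).choose, fun x => by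
    rw [(step i h.1 h.2).choose_spec]; simp [hC]⟩
  let H : ∀ i, Q i := fun i => Nat.rec ⟨h₀, hh₀⟩ next i
  refine ⟨fun i => (H i).1, rfl, fun i x => ?_⟩
  have : dD (i + 1) ((H (i + 1)).1 x) = (θ (i + 1) - (H i).1 ∘ₗ dC i) x :=
    (step i (H i).1 (H i).2).choose_spec x
  rw [this]; simp

/-- An exact augmented complex of free modules over a projective algebra which resolves a
projective module is linearly contractible over the base. -/
theorem exists_contraction {T R : Type*} [CommRing T] [CommRing R] [Algebra T R]
    [Module.Projective T R] {ι : ℕ → Type*} [∀ i, Finite (ι i)] {M : Type*} [AddCommGroup M]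
    [Module R M] [Module T M] [IsScalarTower T R M] [Module.Projective T M]
    (d : ∀ i, (ι (i + 1) → R) →ₗ[R] (ι i → R)) (aug : (ι 0 → R) →ₗ[R] M)
    (haug : Function.Surjective aug) (h₀ : Function.Exact (d 0) aug)
    (hd : ∀ i, Function.Exact (d (i + 1)) (d i)) :
    ∃ (s : M →ₗ[T] (ι 0 → R)) (h : ∀ i, (ι i → R) →ₗ[T] (ι (i + 1) → R)),
      (∀ v, d 0 (h 0 v) + s (aug v) = v) ∧ ∀ i v, d (i + 1) (h (i + 1) v) + h i (d i v) = v := by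
  have : ∀ i, Module.Projective T (ι i → R) := fun i => by
    classical
    have := Fintype.ofFinite (ι i)
    exact .of_equiv' (DFinsupp.linearEquivFunOnFintype (R := T) (M := fun _ : ι i => R))
  obtain ⟨s, hs⟩ := Module.projective_lifting_property (aug.restrictScalars T) .id haug
  replace hs : ∀ m, aug (s m) = m := LinearMap.congr_fun hs
  obtain ⟨k, hk⟩ := Module.Projective.exists_lift_of_mem_range ((d 0).restrictScalars T)
    (.id - s ∘ₗ aug.restrictScalars T) (fun v => by
      obtain ⟨w, hw⟩ := (h₀ (v - s (aug v))).1 (by simp [hs])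
      exact ⟨w, hw⟩)
  replace hk : ∀ v, d 0 (k v) = v - s (aug v) := hk
  -- A contraction is a null-homotopy of the identity; `k` starts it.
  obtain ⟨h, h1, h2⟩ := exists_nullHomotopy (C := fun i => ι i → R)
    (D := fun i => ι i → R) (fun i => (d i).restrictScalars T)
    (fun i => (d i).restrictScalars T) (fun i => (hd i).apply_apply_eq_zero)
    hd (fun i => .id) (fun i x => rfl) k (fun x => by
      change d 0 (k (d 0 x)) = d 0 x
      rw [hk, h₀.apply_apply_eq_zero]; simp)
  exact ⟨s, h, fun v => by rw [h1, hk]; simp, h2⟩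

end Homotopy

/-! ### Projectivity over the polynomial ring in the complementary variables. -/

section BaseChange

open TensorProduct

/-- A linear map over a subring preserves vectors with entries in an ideal generated by elements of
the subring. -/
theorem LinearMap.apply_mem_of_forall_mem_span {T R : Type*} [CommRing T] [CommRing R]
    [Algebra T R] {α β : Type*} [Finite α] (S : Set T) (s : (α → R) →ₗ[T] (β → R)) {v : α → R}
    (hv : ∀ k, v k ∈ Ideal.span (algebraMap T R '' S)) (l : β) :
    s v l ∈ Ideal.span (algebraMap T R '' S) := by
  classical
  have := Fintype.ofFinite α
  -- `s` is only `T`-linear, so the arbitrary factor `r : R` is kept in the claim to absorb the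
  -- `R`-coefficients of the span.
  have key : ∀ a ∈ Ideal.span (algebraMap T R '' S), ∀ k (r : R),
      s (Pi.single k (r * a)) l ∈ Ideal.span (algebraMap T R '' S) := by
    intro a ha k
    induction ha using Submodule.span_induction with
    | mem a ha =>
      obtain ⟨t, ht, rfl⟩ := ha
      intro r
      have : (Pi.single k (r * algebraMap T R t) : α → R) = t • Pi.single k r := by
        rw [← Pi.single_smul, Algebra.smul_def, mul_comm]
      rw [this, map_smul, Pi.smul_apply, Algebra.smul_def]
      exact Ideal.mul_mem_right _ _ (Ideal.subset_span ⟨t, ht, rfl⟩)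
    | zero => simp
    | add a b _ _ iha ihb =>
      intro r
      rw [mul_add, Pi.single_add, map_add]
      exact add_mem (iha r) (ihb r)
    | smul c a _ ih =>
      intro r
      rw [smul_eq_mul, ← mul_assoc]
      exact ih _
  rw [← Finset.univ_sum_single v, map_sum, Finset.sum_apply]
  exact sum_mem fun k _ => by simpa using key _ (hv k) k 1

/-- The polynomial ring in the variables of `Bᶜ`, acting on the polynomial ring in all
variables. -/
noncomputable abbrev renameComplAlgebra {σ : Type*} (K : Type*) [Field K] (B : Set σ) :
    Algebra (MvPolynomial ↥Bᶜ K) (MvPolynomial σ K) :=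
  (MvPolynomial.rename (R := K) (Subtype.val : ↥Bᶜ → σ)).toRingHom.toAlgebra

attribute [local instance] renameComplAlgebra

variable {σ K : Type*} [Field K] (B : Set σ)

/-- `K[σ]` is the tensor product of `K[Bᶜ]` and `K[B]`. -/
theorem exists_tensorEquiv_compl :
    ∃ e : MvPolynomial ↥Bᶜ K ⊗[K] MvPolynomial ↥B K ≃ₐ[MvPolynomial ↥Bᶜ K] MvPolynomial σ K,
      ∀ p, e (1 ⊗ₜ p) = MvPolynomial.rename Subtype.val p := by
  classical
  have : IsScalarTower K (MvPolynomial ↥Bᶜ K) (MvPolynomial σ K) :=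
    .of_algebraMap_eq' (MvPolynomial.rename (R := K) (Subtype.val : ↥Bᶜ → σ)).comp_algebraMap.symm
  let f : MvPolynomial ↥Bᶜ K ⊗[K] MvPolynomial ↥B K →ₐ[MvPolynomial ↥Bᶜ K] MvPolynomial σ K :=
    Algebra.TensorProduct.lift (Algebra.ofId _ _) (MvPolynomial.rename Subtype.val)
      fun _ _ => Commute.all _ _
  -- `g` is known to be bijective but is only `K`-linear, while `f` is `K[Bᶜ]`-linear; agreement on
  -- the variables transfers bijectivity.
  let g := (MvPolynomial.tensorEquivSum K ↥Bᶜ ↥B K).trans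
    (MvPolynomial.renameEquiv K ((Equiv.sumComm _ _).trans (Equiv.Set.sumCompl B)))
  have hfg : f.restrictScalars K = g.toAlgHom := by
    ext i
    · simp [f, g, Algebra.ofId_apply, RingHom.algebraMap_toAlgebra]
    · simp [f, g]
  have hf : Function.Bijective f := by
    have : (f : _ → MvPolynomial σ K) = g := funext fun x => AlgHom.congr_fun hfg x
    rw [this]; exact g.bijective
  exact ⟨AlgEquiv.ofBijective f hf, fun p => by simp [f]⟩

theorem projective_mvPolynomial_compl :
    Module.Projective (MvPolynomial ↥Bᶜ K) (MvPolynomial σ K) := by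
  obtain ⟨e, -⟩ := exists_tensorEquiv_compl (K := K) B
  exact .of_equiv' e.toLinearEquiv

/-- `J` is extended from an ideal `J'` of `K[B]`, so `R/J ≅ K[Bᶜ] ⊗ K[B]/J'` is a base change of a
`K`-vector space. -/
theorem projective_quotient_compl {J : Ideal (MvPolynomial σ K)} {S : Set (MvPolynomial σ K)}
    (hS : S ⊆ MvPolynomial.supported K B) (hJ : Ideal.span S = J) :
    Module.Projective (MvPolynomial ↥Bᶜ K) (MvPolynomial σ K ⧸ J) := by
  obtain ⟨e, he⟩ := exists_tensorEquiv_compl (K := K) B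
  rw [MvPolynomial.supported_eq_range_rename] at hS
  let S₀ : Set (MvPolynomial ↥B K) := MvPolynomial.rename Subtype.val ⁻¹' S
  have h1 : MvPolynomial.rename Subtype.val '' S₀ = S := Set.image_preimage_eq_of_subset hS
  let J₀ := (Ideal.span S₀).map (Algebra.TensorProduct.includeRight (R := K)
    (A := MvPolynomial ↥Bᶜ K) (B := MvPolynomial ↥B K))
  have h2 : J = J₀.map (e : _ →+* MvPolynomial σ K) := by
    simp only [J₀, Ideal.map_span, ← hJ, Set.image_image]
    rw [← h1]
    congr 1
    exact Set.image_congr fun p _ => (he p).symm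
  let e' := (Algebra.TensorProduct.tensorQuotientEquiv (R := K) (MvPolynomial ↥Bᶜ K)
    (MvPolynomial ↥B K) (MvPolynomial ↥Bᶜ K) (Ideal.span S₀)).trans
    (Ideal.quotientEquivAlg J₀ J e h2)
  exact .of_equiv' e'.toLinearEquiv

end BaseChange

/-! ### Homogeneous components and graded lifts. -/

section Grading

variable {σ K : Type*} [Field K]

/-- The homogeneous component of integer degree of a polynomial. -/
noncomputable def polyComponent (σ K : Type*) [Field K] :
    ℤ → MvPolynomial σ K →ₗ[K] MvPolynomial σ K
  | Int.ofNat m => MvPolynomial.homogeneousComponent m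
  | Int.negSucc _ => 0

theorem polyComponent_mem (z : ℤ) (p : MvPolynomial σ K) :
    polyComponent σ K z p ∈ polyDegreePart σ K z := by
  cases z with
  | ofNat m => exact MvPolynomial.homogeneousComponent_isHomogeneous m p
  | negSucc m => exact Submodule.zero_mem _

theorem polyComponent_of_mem {z w : ℤ} {p : MvPolynomial σ K} (hp : p ∈ polyDegreePart σ K z) :
    polyComponent σ K w p = if w = z then p else 0 := by
  cases z with
  | ofNat m =>
    cases w with
    | ofNat l =>
      have := MvPolynomial.homogeneousComponent_of_mem (m := l) hp
      simpa [polyComponent] using this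
    | negSucc l => simp [polyComponent]
  | negSucc m =>
    obtain rfl : p = 0 := hp
    simp

theorem mul_mem_polyDegreePart {y z : ℤ} {p q : MvPolynomial σ K}
    (hp : p ∈ polyDegreePart σ K y) (hq : q ∈ polyDegreePart σ K z) :
    p * q ∈ polyDegreePart σ K (y + z) := by
  cases y with
  | ofNat m =>
    cases z with
    | ofNat l => exact MvPolynomial.IsHomogeneous.mul hp hq
    | negSucc l =>
      obtain rfl : q = 0 := hq
      simp
  | negSucc m =>
    obtain rfl : p = 0 := hp
    simp

theorem one_mem_polyDegreePart_zero : (1 : MvPolynomial σ K) ∈ polyDegreePart σ K 0 :=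
  MvPolynomial.isHomogeneous_one σ K

theorem mem_span_range_X_of_mem_polyDegreePart {z : ℤ} (hz : 0 < z) {p : MvPolynomial σ K}
    (hp : p ∈ polyDegreePart σ K z) :
    p ∈ Ideal.span (Set.range (MvPolynomial.X : σ → MvPolynomial σ K)) := by
  cases z with
  | ofNat m =>
    rw [← Set.image_univ, MvPolynomial.mem_ideal_span_X_image]
    intro s hs
    by_contra! h
    obtain rfl : s = 0 := Finsupp.ext fun i => by simpa using h i
    have h0 : Finsupp.weight (1 : σ → ℕ) 0 = m :=
      (hp : p.IsHomogeneous m) (MvPolynomial.mem_support_iff.1 hs)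
    rw [map_zero] at h0
    simp [← h0] at hz
  | negSucc m => exact absurd hz (by simp)

theorem one_notMem_span_range_X :
    (1 : MvPolynomial σ K) ∉ Ideal.span (Set.range (MvPolynomial.X : σ → MvPolynomial σ K)) := by
  classical
  rw [← Set.image_univ, MvPolynomial.mem_ideal_span_X_image]
  intro h
  simpa using h 0 (by simp)

theorem polyComponent_mem_ideal {L : Ideal (MvPolynomial σ K)}
    (hL : L.IsHomogeneous (MvPolynomial.homogeneousSubmodule σ K)) (z : ℤ) {p : MvPolynomial σ K}
    (hp : p ∈ L) : polyComponent σ K z p ∈ L := by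
  cases z with
  | ofNat m =>
    have := hL m hp
    change MvPolynomial.homogeneousComponent m p ∈ L
    rwa [← MvPolynomial.decomposition.decompose'_apply p m]
  | negSucc m => exact Submodule.zero_mem _

variable {κ κ' : Type*}

/-- The homogeneous component of degree `j` of a vector of a graded free module. -/
noncomputable def freeComponent (d : κ → ℤ) (j : ℤ) :
    (κ → MvPolynomial σ K) →ₗ[K] (κ → MvPolynomial σ K) :=
  LinearMap.pi fun k => polyComponent σ K (j - d k) ∘ₗ LinearMap.proj k

theorem freeComponent_mem (d : κ → ℤ) (j : ℤ) (v : κ → MvPolynomial σ K) :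
    freeComponent d j v ∈ freeDegreePart d j :=
  fun k => polyComponent_mem (j - d k) (v k)

theorem freeComponent_of_mem {d : κ → ℤ} {i j : ℤ} {v : κ → MvPolynomial σ K}
    (hv : v ∈ freeDegreePart d i) : freeComponent d j v = if j = i then v else 0 := by
  ext1 k
  have := polyComponent_of_mem (w := j - d k) (hv k)
  simp only [sub_left_inj] at this
  change polyComponent σ K (j - d k) (v k) = _
  rw [this]
  split_ifs <;> rfl

theorem single_mem_freeDegreePart [DecidableEq κ] {d : κ → ℤ} {j : ℤ} {k : κ}
    {p : MvPolynomial σ K} (hp : p ∈ polyDegreePart σ K (j - d k)) :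
    Pi.single k p ∈ freeDegreePart d j := by
  intro l
  by_cases h : l = k
  · subst h; simpa using hp
  · simp [h]

theorem single_one_mem_freeDegreePart [DecidableEq κ] (d : κ → ℤ) (k : κ) :
    (Pi.single k 1 : κ → MvPolynomial σ K) ∈ freeDegreePart d (d k) :=
  single_mem_freeDegreePart (by rw [sub_self]; exact one_mem_polyDegreePart_zero)

theorem iSup_freeDegreePart [Finite κ] (d : κ → ℤ) :
    ⨆ j, freeDegreePart (σ := σ) (K := K) d j = ⊤ := by
  classical
  have := Fintype.ofFinite κ
  rw [eq_top_iff]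
  intro v _
  rw [← Finset.univ_sum_single v]
  refine sum_mem fun k _ => ?_
  rw [← MvPolynomial.sum_homogeneousComponent (v k)]
  rw [← LinearMap.single_apply (R := K), map_sum]
  refine sum_mem fun i _ => Submodule.mem_iSup_of_mem (i + d k) ?_
  refine single_mem_freeDegreePart ?_
  rw [add_sub_cancel_right]
  exact MvPolynomial.homogeneousComponent_isHomogeneous i (v k)

theorem freeDegreePart_induction [Finite κ] (d : κ → ℤ)
    {P : (κ → MvPolynomial σ K) → Prop} (v : κ → MvPolynomial σ K)
    (mem : ∀ j, ∀ v ∈ freeDegreePart d j, P v) (zero : P 0)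
    (add : ∀ v w, P v → P w → P (v + w)) : P v :=
  Submodule.iSup_induction (freeDegreePart d) (motive := P)
    (iSup_freeDegreePart (σ := σ) (K := K) d ▸ Submodule.mem_top : v ∈ _) mem zero add

theorem map_freeComponent [Finite κ] {d : κ → ℤ} {d' : κ' → ℤ}
    (f : (κ → MvPolynomial σ K) →ₗ[MvPolynomial σ K] (κ' → MvPolynomial σ K))
    (hf : ∀ j, ∀ v ∈ freeDegreePart d j, f v ∈ freeDegreePart d' j) (j : ℤ)
    (v : κ → MvPolynomial σ K) : f (freeComponent d j v) = freeComponent d' j (f v) := by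
  induction v using freeDegreePart_induction d with
  | mem i v hv =>
    rw [freeComponent_of_mem hv, freeComponent_of_mem (hf i v hv)]
    split_ifs <;> simp
  | zero => simp
  | add v w hv hw => simp [hv, hw]

theorem exists_mem_freeDegreePart_of_mem_range [Finite κ] {d : κ → ℤ} {d' : κ' → ℤ}
    (f : (κ → MvPolynomial σ K) →ₗ[MvPolynomial σ K] (κ' → MvPolynomial σ K))
    (hf : ∀ j, ∀ v ∈ freeDegreePart d j, f v ∈ freeDegreePart d' j) {j : ℤ}
    {x : κ' → MvPolynomial σ K} (hx : x ∈ freeDegreePart d' j) (hxf : x ∈ Set.range f) :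
    ∃ v ∈ freeDegreePart d j, f v = x := by
  obtain ⟨v, rfl⟩ := hxf
  exact ⟨freeComponent d j v, freeComponent_mem d j v, by
    rw [map_freeComponent f hf, freeComponent_of_mem hx, if_pos rfl]⟩

theorem exists_mem_freeDegreePart_of_mem_quotientDegreePart [Finite κ] {d : κ → ℤ}
    {L : Ideal (MvPolynomial σ K)} (hL : L.IsHomogeneous (MvPolynomial.homogeneousSubmodule σ K))
    (f : (κ → MvPolynomial σ K) →ₗ[MvPolynomial σ K] MvPolynomial σ K ⧸ L)
    (hf : ∀ j, ∀ v ∈ freeDegreePart d j, f v ∈ quotientDegreePart L j)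
    (hsurj : Function.Surjective f) {j : ℤ} {x : MvPolynomial σ K ⧸ L}
    (hx : x ∈ quotientDegreePart L j) : ∃ v ∈ freeDegreePart d j, f v = x := by
  -- One representative `q` of `f v` is chosen whose components represent the images of all
  -- components of `v`. Homogeneity of `L` then makes the choice of representative harmless.
  have key : ∀ v, ∃ q : MvPolynomial σ K, f v = Ideal.Quotient.mk L q ∧
      ∀ j, f (freeComponent d j v) = Ideal.Quotient.mk L (polyComponent σ K j q) := by
    intro v
    induction v using freeDegreePart_induction d with
    | mem i v hv =>
      obtain ⟨q, hq, hqv⟩ := hf i v hv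
      refine ⟨q, hqv.symm, fun j => ?_⟩
      rw [freeComponent_of_mem hv, polyComponent_of_mem hq]
      split_ifs
      · exact hqv.symm
      · simp
    | zero => exact ⟨0, by simp⟩
    | add v w hv hw =>
      obtain ⟨p, hp, hp'⟩ := hv
      obtain ⟨q, hq, hq'⟩ := hw
      exact ⟨p + q, by simp [hp, hq], fun j => by simp [hp', hq']⟩
  obtain ⟨v, rfl⟩ := hsurj x
  obtain ⟨q, hq, hqv⟩ := hx
  obtain ⟨p, hp, hp'⟩ := key v
  refine ⟨freeComponent d j v, freeComponent_mem d j v, ?_⟩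
  rw [hp', ← hqv]
  have h1 : polyComponent σ K j q = q := by rw [polyComponent_of_mem hq, if_pos rfl]
  change Ideal.Quotient.mk L _ = Ideal.Quotient.mk L q
  rw [← h1, Ideal.Quotient.eq, ← map_sub]
  refine polyComponent_mem_ideal hL j ?_
  rw [← Ideal.Quotient.eq, ← hp]
  exact hqv.symm

/-- A linear map of free modules defined by homogeneous lifts of the images of the basis
vectors. -/
theorem exists_graded_lift [Finite κ] {N : Type*} [AddCommGroup N] [Module (MvPolynomial σ K) N]
    [DecidableEq κ] {d : κ → ℤ} {d' : κ' → ℤ}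
    (g : (κ' → MvPolynomial σ K) →ₗ[MvPolynomial σ K] N)
    (f : (κ → MvPolynomial σ K) →ₗ[MvPolynomial σ K] N)
    (H : ∀ k, ∃ w ∈ freeDegreePart d' (d k), g w = f (Pi.single k 1)) :
    ∃ h : (κ → MvPolynomial σ K) →ₗ[MvPolynomial σ K] (κ' → MvPolynomial σ K),
      (∀ j, ∀ v ∈ freeDegreePart d j, h v ∈ freeDegreePart d' j) ∧ ∀ v, g (h v) = f v := by
  have := Fintype.ofFinite κ
  choose w hw hgw using H
  refine ⟨Fintype.linearCombination _ w, fun j v hv => ?_, fun v => ?_⟩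
  · rw [Fintype.linearCombination_apply]
    refine sum_mem fun k _ l => ?_
    have := mul_mem_polyDegreePart (hv k) (hw k l)
    rwa [sub_add_sub_cancel] at this
  · rw [Fintype.linearCombination_apply, map_sum, LinearMap.pi_apply_eq_sum_univ f v]
    refine Finset.sum_congr rfl fun k _ => ?_
    rw [map_smul, hgw]
    congr 2
    ext1 l
    simp [Pi.single_apply, eq_comm]

end Grading

/-! ### Independence of the shifts from the minimal resolution. -/

namespace GradedFreeResolution

attribute [local instance] fintype_ι

section Comparison

variable {σ K : Type*} [Field K] {L : Ideal (MvPolynomial σ K)}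

/-- Comparison of two graded free resolutions of `R ⧸ L`. -/
theorem exists_comparison (hL : L.IsHomogeneous (MvPolynomial.homogeneousSubmodule σ K))
    (F G : GradedFreeResolution σ (quotientDegreePart L)) :
    ∃ φ : ∀ i, (F.ι i → MvPolynomial σ K) →ₗ[MvPolynomial σ K] (G.ι i → MvPolynomial σ K),
      (∀ i j, ∀ v ∈ freeDegreePart (F.deg i) j, φ i v ∈ freeDegreePart (G.deg i) j) ∧
      (∀ v, G.aug (φ 0 v) = F.aug v) ∧
      ∀ i v, G.diff i (φ (i + 1) v) = φ i (F.diff i v) := by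
  classical
  let Q : ℕ → Type _ := fun i =>
    {φ : (F.ι i → MvPolynomial σ K) →ₗ[MvPolynomial σ K] (G.ι i → MvPolynomial σ K) //
      (∀ j, ∀ v ∈ freeDegreePart (F.deg i) j, φ v ∈ freeDegreePart (G.deg i) j) ∧
      ∀ v, φ (F.diff i v) ∈ Set.range (G.diff i)}
  obtain ⟨φ₀, hφ₀, haug⟩ := exists_graded_lift (d := F.deg 0) (d' := G.deg 0) G.aug F.aug
    fun k => exists_mem_freeDegreePart_of_mem_quotientDegreePart hL G.aug G.aug_mem
      G.aug_surjective (F.aug_mem _ _ (single_one_mem_freeDegreePart (F.deg 0) k))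
  have step : ∀ i (φ : Q i), ∃ ψ : Q (i + 1), ∀ v, G.diff i (ψ.1 v) = φ.1 (F.diff i v) := by
    rintro i ⟨φ, h1, h2⟩
    obtain ⟨ψ, hψ, hψφ⟩ := exists_graded_lift (d := F.deg (i + 1)) (d' := G.deg (i + 1))
      (G.diff i) (φ ∘ₗ F.diff i) fun k =>
        exists_mem_freeDegreePart_of_mem_range (G.diff i) (G.diff_mem i)
          (h1 _ _ (F.diff_mem i _ _ (single_one_mem_freeDegreePart (F.deg (i + 1)) k))) (h2 _)
    refine ⟨⟨ψ, hψ, fun v => ?_⟩, hψφ⟩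
    rw [← G.exact_succ i, hψφ]
    simp [(F.exact_succ i).apply_apply_eq_zero]
  let Φ : ∀ i, Q i := fun i => Nat.rec
    ⟨φ₀, hφ₀, fun v => by
      rw [← G.exact_zero, haug]
      exact F.exact_zero.apply_apply_eq_zero v⟩ (fun i φ => (step i φ).choose) i
  exact ⟨fun i => (Φ i).1, fun i => (Φ i).2.1, haug, fun i => (step i (Φ i)).choose_spec⟩

/-- A self-map of a minimal resolution lifting zero has entries in the maximal ideal. -/
theorem IsMinimal.apply_mem_of_aug_eq_zero {F : GradedFreeResolution σ (quotientDegreePart L)}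
    (hF : F.IsMinimal)
    (θ : ∀ i, (F.ι i → MvPolynomial σ K) →ₗ[MvPolynomial σ K] (F.ι i → MvPolynomial σ K))
    (hθ₀ : ∀ v, F.aug (θ 0 v) = 0) (hθ : ∀ i v, F.diff i (θ (i + 1) v) = θ i (F.diff i v))
    (i : ℕ) (v k) : θ i v k ∈ Ideal.span (Set.range (MvPolynomial.X : σ → MvPolynomial σ K)) := by
  obtain ⟨h₀, hh₀⟩ := Module.Projective.exists_lift_of_mem_range (F.diff 0) (θ 0)
    fun v => (F.exact_zero _).1 (hθ₀ v)
  obtain ⟨h, rfl, hh⟩ := exists_nullHomotopy (C := fun i => F.ι i → MvPolynomial σ K)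
    (D := fun i => F.ι i → MvPolynomial σ K) F.diff F.diff
    (fun i => (F.exact_succ i).apply_apply_eq_zero) F.exact_succ θ hθ h₀ fun x => hh₀ _
  -- Here `θ = d h + h d`. The first term has entries in `𝔪` by minimality, the second because `h`
  -- is `R`-linear and `d v` has entries in `𝔪`.
  cases i with
  | zero => rw [← hh₀]; exact hF _ _ _
  | succ i =>
    rw [← hh, Pi.add_apply]
    refine add_mem (hF _ _ _) ?_
    have := LinearMap.apply_mem_of_forall_mem_span (T := MvPolynomial σ K)
      (Set.range MvPolynomial.X) (h i) (v := F.diff i v) (by simpa using hF i v) k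
    simpa using this

/-- If every generator of `G i` had smaller degree than some generator `e` of `F i`, then `φ e`,
hence `ψ (φ e)`, would have entries in `𝔪`. But `ψ ∘ φ - id` lifts zero, so its entries lie in `𝔪`
too, forcing `1 ∈ 𝔪`. -/
theorem IsMinimal.t_le (hL : L.IsHomogeneous (MvPolynomial.homogeneousSubmodule σ K))
    {F : GradedFreeResolution σ (quotientDegreePart L)} (hF : F.IsMinimal)
    (G : GradedFreeResolution σ (quotientDegreePart L)) (i : ℕ) : F.t i ≤ G.t i := by
  classical
  obtain ⟨φ, hφ, hφ₀, hφd⟩ := exists_comparison hL F G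
  obtain ⟨ψ, -, hψ₀, hψd⟩ := exists_comparison hL G F
  refine Finset.sup_le fun k _ => ?_
  by_contra! hk
  have hlt : ∀ l, G.deg i l < F.deg i k := fun l => WithBot.coe_lt_coe.1
    (lt_of_le_of_lt (Finset.le_sup (f := fun l => (G.deg i l : WithBot ℤ)) (Finset.mem_univ l)) hk)
  have h1 : ∀ l, φ i (Pi.single k 1) l ∈
      Ideal.span (Set.range (MvPolynomial.X : σ → MvPolynomial σ K)) := fun l =>
    mem_span_range_X_of_mem_polyDegreePart (sub_pos.2 (hlt l))
      (hφ i _ _ (single_one_mem_freeDegreePart (F.deg i) k) l)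
  have h2 := LinearMap.apply_mem_of_forall_mem_span (T := MvPolynomial σ K)
    (Set.range MvPolynomial.X) (ψ i) (v := φ i (Pi.single k 1)) (by simpa using h1) k
  have h3 := hF.apply_mem_of_aug_eq_zero (fun i => ψ i ∘ₗ φ i - .id) (fun v => by
    simp [hφ₀, hψ₀]) (fun i v => by simp [hφd, hψd]) i (Pi.single k 1) k
  simp only [Algebra.algebraMap_self, RingHom.id_apply, Set.image_id'] at h2
  have h4 := sub_mem h2 h3
  simp at h4
  exact one_notMem_span_range_X h4

theorem IsMinimal.t_eq (hL : L.IsHomogeneous (MvPolynomial.homogeneousSubmodule σ K))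
    {F G : GradedFreeResolution σ (quotientDegreePart L)} (hF : F.IsMinimal) (hG : G.IsMinimal) :
    F.t = G.t :=
  funext fun i => le_antisymm (hF.t_le hL G i) (hG.t_le hL F i)

theorem t_eq_bot_of_length_lt (F : GradedFreeResolution σ (quotientDegreePart L)) {i : ℕ}
    (hi : F.length < i) : F.t i = ⊥ := by
  have := F.isEmpty_of_length_lt i hi
  exact (Finset.sup_eq_bot_iff _ _).2 fun k => isEmptyElim k

/-- Past the length the left side is `-∞`, so the bound on `a + b` can be dropped. -/
theorem Subadditive.t_add_le {F : GradedFreeResolution σ (quotientDegreePart L)}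
    (hF : F.Subadditive) (a b : ℕ) : F.t (a + b) ≤ F.t a + F.t b := by
  by_cases h : a + b ≤ F.length
  · exact hF a b h
  · rw [F.t_eq_bot_of_length_lt (not_le.1 h)]
    exact bot_le

/-- Subadditivity can be checked on one minimal resolution. -/
theorem IsMinimal.subadditivityHolds
    (hL : L.IsHomogeneous (MvPolynomial.homogeneousSubmodule σ K))
    {F : GradedFreeResolution σ (quotientDegreePart L)} (hF : F.IsMinimal)
    (h : ∀ a b, F.t (a + b) ≤ F.t a + F.t b) : SubadditivityHolds L :=
  ⟨⟨F, hF⟩, fun G hG a b _ => by rw [hG.t_eq hL hF]; exact h a b⟩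

end Comparison

end GradedFreeResolution

/-! ### The total tensor complex, with elements of `F i ⊗ G j` as matrices. -/

namespace TensorComplex

variable {R : Type*} [CommRing R]

section Matrices

variable {α β γ δ : Type*}

/-- A linear functional applied to the columns of a matrix. -/
def colFun (f : (α → R) →ₗ[R] R) : (α → γ → R) →ₗ[R] (γ → R) :=
  LinearMap.pi fun c => f ∘ₗ LinearMap.pi fun a => LinearMap.proj c ∘ₗ LinearMap.proj a

/-- A linear map applied to the columns of a matrix. -/
def colMap (f : (α → R) →ₗ[R] (β → R)) : (α → γ → R) →ₗ[R] (β → γ → R) :=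
  LinearMap.pi fun b => colFun (LinearMap.proj b ∘ₗ f)

theorem colFun_eq_sum [Fintype α] [DecidableEq α] (f : (α → R) →ₗ[R] R) (w : α → γ → R) :
    colFun f w = ∑ a, f (fun b => if a = b then 1 else 0) • w a := by
  ext1 c
  rw [Finset.sum_apply]
  refine (LinearMap.pi_apply_eq_sum_univ f fun a => w a c).trans ?_
  exact Finset.sum_congr rfl fun a _ => mul_comm _ _

theorem colFun_compLeft [Finite α] (f : (α → R) →ₗ[R] R) (g : (γ → R) →ₗ[R] (δ → R))
    (w : α → γ → R) : colFun f (g.compLeft α w) = g (colFun f w) := by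
  classical
  have := Fintype.ofFinite α
  rw [colFun_eq_sum, colFun_eq_sum, map_sum]
  simp

theorem colMap_compLeft [Finite α] (f : (α → R) →ₗ[R] (β → R)) (g : (γ → R) →ₗ[R] (δ → R))
    (w : α → γ → R) : colMap f (g.compLeft α w) = g.compLeft β (colMap f w) :=
  funext fun b => colFun_compLeft (LinearMap.proj (R := R) (φ := fun _ : β => R) b ∘ₗ f) g w

theorem colMap_colMap_eq_zero {f : (α → R) →ₗ[R] (β → R)} {g : (β → R) →ₗ[R] (γ → R)}
    (h : ∀ v, g (f v) = 0) (w : α → δ → R) : colMap g (colMap f w) = 0 :=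
  funext fun c => funext fun d => congrFun (h fun a => w a d) c

theorem exists_colMap_eq {f : (α → R) →ₗ[R] (β → R)} {w : β → δ → R}
    (h : ∀ d, (fun b => w b d) ∈ Set.range f) : ∃ v, colMap f v = w := by
  choose v hv using h
  exact ⟨fun a d => v d a, funext fun b => funext fun d => congrFun (hv d) b⟩

/-- Entries of a vector in an ideal are preserved by linear functionals. -/
theorem apply_mem_of_forall_mem [Finite α] {I : Ideal R} (f : (α → R) →ₗ[R] R) {v : α → R}
    (hv : ∀ a, v a ∈ I) : f v ∈ I := by
  classical
  have := Fintype.ofFinite α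
  rw [LinearMap.pi_apply_eq_sum_univ f v]
  exact sum_mem fun a _ => Ideal.mul_mem_right _ _ (hv a)

end Matrices

variable {ι ι' : ℕ → Type}

/-- The index type of the basis of the degree-`c` part of the total tensor product. -/
abbrev Index (ι ι' : ℕ → Type) (c : ℕ) : Type :=
  {x : Σ i j : ℕ, ι i × ι' j // x.1 + x.2.1 = c}

instance [∀ i, Finite (ι i)] [∀ i, Finite (ι' i)] (c : ℕ) : Finite (Index ι ι' c) := by
  refine Finite.of_injective (β := Σ i : Fin (c + 1), Σ j : Fin (c + 1), ι i × ι' j)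
    (fun x => ⟨⟨x.1.1, by have := x.2; omega⟩, ⟨x.1.2.1, by have := x.2; omega⟩, x.1.2.2⟩) ?_
  rintro ⟨⟨i, j, k⟩, h⟩ ⟨⟨i', j', k'⟩, h'⟩ heq
  simp only [Sigma.mk.injEq, Fin.mk.injEq] at heq
  obtain ⟨rfl, heq⟩ := heq
  simp only [heq_eq_eq, Sigma.mk.injEq, Fin.mk.injEq] at heq
  obtain ⟨rfl, heq⟩ := heq
  simp only [heq_eq_eq] at heq
  subst heq
  rfl

/-- The component in `F i ⊗ G j`. -/
def comp {c : ℕ} (i j : ℕ) (h : i + j = c) : (Index ι ι' c → R) →ₗ[R] (ι i → ι' j → R) :=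
  LinearMap.pi fun k => LinearMap.pi fun l => LinearMap.proj ⟨⟨i, j, k, l⟩, h⟩

/-- The vector with given components. -/
def ofComp {c : ℕ} (v : ∀ i j, i + j = c → ι i → ι' j → R) : Index ι ι' c → R :=
  fun x => v x.1.1 x.1.2.1 x.2 x.1.2.2.1 x.1.2.2.2

theorem ext_comp {c : ℕ} {v w : Index ι ι' c → R} (h : ∀ i j hc, comp i j hc v = comp i j hc w) :
    v = w :=
  funext fun ⟨⟨i, j, k, l⟩, hc⟩ => congrFun (congrFun (h i j hc) k) l

theorem comp_ofComp {c : ℕ} (v : ∀ i j, i + j = c → ι i → ι' j → R) (i j : ℕ) (h : i + j = c) :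
    comp i j h (ofComp v) = v i j h := rfl

variable (d : ∀ i, (ι (i + 1) → R) →ₗ[R] (ι i → R)) (d' : ∀ i, (ι' (i + 1) → R) →ₗ[R] (ι' i → R))

/-- The component in `F i ⊗ G j` of the differential of the total tensor product. -/
def diffComp {c : ℕ} (i j : ℕ) (h : i + 1 + j = c) : (Index ι ι' c → R) →ₗ[R] (ι i → ι' j → R) :=
  colMap (d i) ∘ₗ comp (i + 1) j h +
    (-1 : R) ^ i • ((d' j).compLeft (ι i) ∘ₗ comp i (j + 1) (by omega))

/-- The differential of the total tensor product. -/
def diff (c : ℕ) : (Index ι ι' (c + 1) → R) →ₗ[R] (Index ι ι' c → R) :=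
  LinearMap.pi fun x => LinearMap.proj x.1.2.2.2 ∘ₗ LinearMap.proj x.1.2.2.1 ∘ₗ
    diffComp d d' x.1.1 x.1.2.1 (by have := x.2; omega)

theorem comp_diff {c : ℕ} (i j : ℕ) (h : i + j = c) (w : Index ι ι' (c + 1) → R) :
    comp i j h (diff d d' c w) = diffComp d d' i j (by omega) w := rfl

theorem diffComp_apply {c : ℕ} (i j : ℕ) (h : i + 1 + j = c) (w : Index ι ι' c → R) :
    diffComp d d' i j h w = colMap (d i) (comp (i + 1) j h w) +
      (-1 : R) ^ i • (d' j).compLeft (ι i) (comp i (j + 1) (by omega) w) := rfl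

theorem diff_eq_zero_iff {c : ℕ} (w : Index ι ι' (c + 1) → R) :
    diff d d' c w = 0 ↔ ∀ i j h, diffComp d d' i j h w = 0 := by
  refine ⟨fun h i j hc => ?_, fun h => ext_comp fun i j hc => ?_⟩
  · rw [← comp_diff d d' i j (by omega), h, map_zero]
  · rw [comp_diff, h, map_zero]

variable {d d'}

/-- Row and column operations commute, so the mixed terms, with signs `(-1)^(i+1)` and `(-1)^i`,
cancel. -/
theorem diffComp_diff [∀ i, Finite (ι i)] (hd : ∀ i v, d i (d (i + 1) v) = 0)
    (hd' : ∀ i v, d' i (d' (i + 1) v) = 0) {c : ℕ} (i j : ℕ) (h : i + 1 + j = c)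
    (w : Index ι ι' (c + 1) → R) : diffComp d d' i j h (diff d d' c w) = 0 := by
  rw [diffComp_apply, comp_diff, comp_diff, diffComp_apply, diffComp_apply, map_add, map_add,
    colMap_colMap_eq_zero (hd i), map_smul, map_smul, colMap_compLeft]
  have : (d' j).compLeft (ι i) ((d' (j + 1)).compLeft (ι i) (comp i (j + 1 + 1) (by omega) w)) = 0 :=
    funext fun k => hd' j _
  rw [this, pow_succ]
  simp

/-- Once the components with `i ≤ m` vanish, the cycle condition at `i = m` says that `d` kills
those at `i = m + 1`. Lift them through `d` to `i = m + 2`; the boundary of this lift does not touch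
`i ≤ m`. -/
theorem exists_comp_sub_diff_eq_zero_succ (hd : ∀ i, Function.Exact (d (i + 1)) (d i)) {c m : ℕ}
    {w : Index ι ι' c → R} (hw : ∀ i j h, diffComp d d' i j h w = 0)
    (hwm : ∀ i j h, i ≤ m → comp i j h w = 0) :
    ∃ u, ∀ i j h, i ≤ m + 1 → comp i j h (w - diff d d' c u) = 0 := by
  classical
  have : ∀ i j (h : i + 1 + j = c), ∃ v : ι (i + 2) → ι' j → R,
      (i = m → colMap (d (i + 1)) v = comp (i + 1) j h w) ∧ (i ≠ m → v = 0) := by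
    intro i j h
    by_cases him : i = m
    · subst him
      obtain ⟨v, hv⟩ := exists_colMap_eq (f := d (i + 1)) (w := comp (i + 1) j h w) fun l => by
        rw [← hd i]
        have := hw i j h
        rw [diffComp_apply, hwm i (j + 1) _ le_rfl, map_zero, smul_zero, add_zero] at this
        exact funext fun k => congrFun (congrFun this k) l
      exact ⟨v, fun _ => hv, fun h => absurd rfl h⟩
    · exact ⟨0, fun h => absurd h him, fun _ => rfl⟩
  choose v hv hv0 using this
  let u : ∀ i j, i + j = c + 1 → ι i → ι' j → R := fun i => match i with
    | 0 => fun _ _ => 0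
    | 1 => fun _ _ => 0
    | i + 2 => fun j h => v i j (by omega)
  have hu : ∀ i j h, i ≤ m + 1 → u i j h = 0 := by
    intro i j h hi
    match i with
    | 0 => rfl
    | 1 => rfl
    | i + 2 => exact hv0 i j _ (by omega)
  refine ⟨ofComp u, fun i j h hi => ?_⟩
  rw [map_sub, comp_diff, diffComp_apply, comp_ofComp, comp_ofComp, hu i _ _ hi, map_zero,
    smul_zero, add_zero]
  rcases Nat.lt_or_ge i (m + 1) with him | him
  · rw [hu _ _ _ (by omega), hwm _ _ _ (by omega)]
    simp
  · obtain rfl : i = m + 1 := by omega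
    rw [sub_eq_zero]
    exact (hv m j h rfl).symm

/-- Exactness of `d` cannot clear the components at `i = 0`, where the augmentation enters, so
`base` supplies that step. -/
theorem exists_diff_eq [∀ i, Finite (ι i)] (hd : ∀ i, Function.Exact (d (i + 1)) (d i))
    (hd' : ∀ i v, d' i (d' (i + 1) v) = 0) {c : ℕ}
    {w : Index ι ι' c → R} (hw : ∀ i j h, diffComp d d' i j h w = 0)
    (base : ∀ j h, ∃ (u : ι 0 → ι' (j + 1) → R) (v : ι 1 → ι' j → R),
      comp 0 j h w = colMap (d 0) v + (d' j).compLeft (ι 0) u) :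
    ∃ u, diff d d' c u = w := by
  have key : ∀ m, ∃ u, ∀ i j h, i ≤ m → comp i j h (w - diff d d' c u) = 0 := by
    intro m
    induction m with
    | zero =>
      choose u v huv using base
      -- The `0, 0` branch is vacuous, since the total degree `c + 1` is positive.
      let x : ∀ i j, i + j = c + 1 → ι i → ι' j → R := fun i j => match i, j with
        | 0, 0 => fun _ => 0
        | 0, j + 1 => fun h => u j (by omega)
        | 1, j => fun h => v j (by omega)
        | _ + 2, _ => fun _ => 0
      refine ⟨ofComp x, fun i j h hi => ?_⟩
      obtain rfl : i = 0 := by omega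
      rw [map_sub, comp_diff, diffComp_apply, comp_ofComp, comp_ofComp, huv, pow_zero, one_smul,
        sub_eq_zero]
    | succ m ih =>
      obtain ⟨u, hu⟩ := ih
      obtain ⟨u', hu'⟩ := exists_comp_sub_diff_eq_zero_succ (d' := d') hd
        (w := w - diff d d' c u) (fun i j h => by
          rw [map_sub, hw, diffComp_diff (fun i => (hd i).apply_apply_eq_zero) hd', sub_zero]) hu
      exact ⟨u + u', fun i j h hi => by rw [map_add, ← sub_sub]; exact hu' i j h hi⟩
  obtain ⟨u, hu⟩ := key c
  refine ⟨u, ext_comp fun i j h => ?_⟩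
  have := hu i j h (by omega)
  rwa [map_sub, sub_eq_zero, eq_comm] at this

section Augmentation

variable {I J : Ideal R} {α : (ι 0 → R) →ₗ[R] R} {β : (ι' 0 → R) →ₗ[R] R}

/-- Lift `y` through `α` to `u`, modulo `I`. Then `α` sends every column of `w - g u` into `I`, so
these columns are in the range of `d 0`. This turns boundaries of `G ⊗ R/I` into the `base` of
`exists_diff_eq`. -/
theorem exists_eq_colMap_add_compLeft [Finite (ι 0)] {γ δ : Type*} [Finite δ]
    (hα : ∀ p, ∃ v, α v - p ∈ I) (hdα : ∀ v, α v ∈ I → v ∈ Set.range (d 0))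
    (g : (δ → R) →ₗ[R] (γ → R)) (w : ι 0 → γ → R) (y : δ → R)
    (h : ∀ l, (colFun α w - g y) l ∈ I) :
    ∃ (u : ι 0 → δ → R) (v : ι 1 → γ → R), w = colMap (d 0) v + g.compLeft (ι 0) u := by
  choose u hu using fun l => hα (y l)
  obtain ⟨v, hv⟩ := exists_colMap_eq (f := d 0)
    (w := w - g.compLeft (ι 0) (fun k l => u l k)) fun l => hdα _ <| by
      change colFun α (w - g.compLeft (ι 0) fun k l => u l k) l ∈ I
      have : colFun α (w - g.compLeft (ι 0) fun k l => u l k) =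
          (colFun α w - g y) - g (colFun α (fun k l => u l k) - y) := by
        rw [map_sub, colFun_compLeft, map_sub]; abel
      rw [this]
      exact sub_mem (h l) (apply_mem_of_forall_mem (LinearMap.proj l ∘ₗ g) hu)
  exact ⟨fun k l => u l k, v, by rw [hv]; abel⟩

variable (α β) in
/-- The lift to the polynomial ring of the augmentation of the total tensor product. -/
def augLift : (Index ι ι' 0 → R) →ₗ[R] R := β ∘ₗ colFun α ∘ₗ comp 0 0 rfl

theorem augLift_mem_iff [∀ i, Finite (ι i)] [∀ i, Finite (ι' i)]
    (hd : ∀ i, Function.Exact (d (i + 1)) (d i)) (hd' : ∀ i v, d' i (d' (i + 1) v) = 0)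
    (hα : ∀ p, ∃ v, α v - p ∈ I) (hdα : ∀ v, α v ∈ I ↔ v ∈ Set.range (d 0))
    (hdβ : ∀ v, β (d' 0 v) ∈ J)
    (hI : ∀ x, β x ∈ I + J → ∃ y, ∀ l, (x - d' 0 y) l ∈ I) (w : Index ι ι' 0 → R) :
    augLift α β w ∈ I + J ↔ w ∈ Set.range (diff d d' 0) := by
  constructor
  · intro h
    obtain ⟨y, hy⟩ := hI _ h
    refine exists_diff_eq hd hd' (fun i j h => by omega) fun j h => ?_
    obtain rfl : j = 0 := by omega
    exact exists_eq_colMap_add_compLeft hα (fun v => (hdα v).1) _ _ _ hy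
  · rintro ⟨u, rfl⟩
    change β (colFun α (comp 0 0 rfl (diff d d' 0 u))) ∈ I + J
    rw [comp_diff, diffComp_apply, map_add, map_smul, colFun_compLeft, map_add, map_smul, pow_zero,
      one_smul]
    exact Submodule.add_mem_sup
      (apply_mem_of_forall_mem β fun l => (hdα _).2 (Set.mem_range_self _)) (hdβ _)

theorem exact_diff [∀ i, Finite (ι i)] [∀ i, Finite (ι' i)]
    (hd : ∀ i, Function.Exact (d (i + 1)) (d i)) (hd' : ∀ i v, d' i (d' (i + 1) v) = 0)
    (hα : ∀ p, ∃ v, α v - p ∈ I) (hdα : ∀ v, α v ∈ I ↔ v ∈ Set.range (d 0))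
    (hI : ∀ j x, (∀ l, d' j x l ∈ I) → ∃ y, ∀ l, (x - d' (j + 1) y) l ∈ I) (c : ℕ) :
    Function.Exact (diff d d' (c + 1)) (diff d d' c) := by
  intro w
  rw [diff_eq_zero_iff]
  constructor
  · intro hw
    refine exists_diff_eq hd hd' hw fun j h => ?_
    obtain rfl : j = c + 1 := by omega
    -- By the cycle condition at `(0, c)`, `α` maps the component at `i = 0` to a cycle modulo `I`.
    obtain ⟨y, hy⟩ := hI c (colFun α (comp 0 (c + 1) h w)) fun l => by
      have := hw 0 c (by omega)
      rw [diffComp_apply, pow_zero, one_smul, add_comm, add_eq_zero_iff_eq_neg] at this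
      rw [← colFun_compLeft, this, map_neg]
      exact neg_mem ((hdα _).2 (Set.mem_range_self _))
    exact exists_eq_colMap_add_compLeft hα (fun v => (hdα v).1) _ _ _ hy
  · rintro ⟨u, rfl⟩ i j h
    exact diffComp_diff (fun i => (hd i).apply_apply_eq_zero) hd' i j h u

end Augmentation

end TensorComplex

/-! ### The tensor product of two resolutions and its shifts. -/

namespace GradedFreeResolution

attribute [local instance] fintype_ι

variable {σ K : Type*} [Field K] {I J : Ideal (MvPolynomial σ K)}

section Acyclicity

attribute [local instance] renameComplAlgebra

/-- Tensoring a free resolution of `R ⧸ J` with `R ⧸ I` preserves exactness if `I` and `J` are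
generated by polynomials in disjoint sets of variables. -/
theorem exists_sub_diff_mem {A B : Set σ} {S T : Set (MvPolynomial σ K)} (hAB : Disjoint A B)
    (hSA : S ⊆ MvPolynomial.supported K A) (hTB : T ⊆ MvPolynomial.supported K B)
    (hSI : Ideal.span S = I) (hTJ : Ideal.span T = J)
    (G : GradedFreeResolution σ (quotientDegreePart J)) :
    (∀ x p, p ∈ I → G.aug x = Ideal.Quotient.mk J p → ∃ y, ∀ l, (x - G.diff 0 y) l ∈ I) ∧
    ∀ j x, (∀ l, G.diff j x l ∈ I) → ∃ y, ∀ l, (x - G.diff (j + 1) y) l ∈ I := by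
  have := projective_mvPolynomial_compl (K := K) B
  have := projective_quotient_compl B hTB hTJ
  obtain ⟨s, h, h0, hs⟩ := exists_contraction (T := MvPolynomial ↥Bᶜ K) G.diff G.aug
    G.aug_surjective G.exact_zero G.exact_succ
  obtain ⟨S₀, hS₀⟩ : ∃ S₀ : Set (MvPolynomial ↥Bᶜ K),
      algebraMap (MvPolynomial ↥Bᶜ K) (MvPolynomial σ K) '' S₀ = S := by
    refine ⟨MvPolynomial.rename Subtype.val ⁻¹' S, Set.image_preimage_eq_of_subset ?_⟩
    have := hSA.trans (MvPolynomial.supported_mono (R := K) hAB.subset_compl_right)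
    rwa [MvPolynomial.supported_eq_range_rename] at this
  rw [← hS₀] at hSI
  subst hSI
  refine ⟨fun x p hp hx => ⟨h 0 x, fun l => ?_⟩, fun j x hx => ⟨h (j + 1) x, fun l => ?_⟩⟩
  -- The contraction leaves `s (aug x)`, the value at `p ∈ I` of the `K[Bᶜ]`-linear map `R → R/J → G
  -- 0`; `Unit` presents `R` as a free module of rank one.
  · have h1 : x - G.diff 0 (h 0 x) = s (Ideal.Quotient.mk J p) := by
      rw [← hx, sub_eq_iff_eq_add', h0]
    rw [h1]
    exact LinearMap.apply_mem_of_forall_mem_span S₀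
      (s ∘ₗ (Ideal.Quotient.mkₐ (MvPolynomial ↥Bᶜ K) J).toLinearMap ∘ₗ
        LinearMap.proj (φ := fun _ : Unit => MvPolynomial σ K) ())
      (v := fun _ => p) (fun _ => hp) l
  · have h1 : x - G.diff (j + 1) (h (j + 1) x) = h j (G.diff j x) := by
      rw [sub_eq_iff_eq_add', hs]
    rw [h1]
    exact LinearMap.apply_mem_of_forall_mem_span S₀ (h j) hx l

end Acyclicity

/-- With `R`-valued augmentations `α` and `β`, the map `F 0 ⊗ G 0 → R/(I+J)` is obtained by
composing them and reducing once. -/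
theorem exists_aug_lift (F : GradedFreeResolution σ (quotientDegreePart I)) :
    ∃ α : (F.ι 0 → MvPolynomial σ K) →ₗ[MvPolynomial σ K] MvPolynomial σ K,
      (∀ v, Ideal.Quotient.mk I (α v) = F.aug v) ∧
      ∀ j, ∀ v ∈ freeDegreePart (F.deg 0) j, α v ∈ polyDegreePart σ K j := by
  classical
  choose a ha haF using fun k =>
    F.aug_mem _ _ (single_one_mem_freeDegreePart (F.deg 0) k)
  obtain ⟨h, hh, hF⟩ := exists_graded_lift (d := F.deg 0) (d' := fun _ : Unit => 0)
    ((Submodule.mkQ I) ∘ₗ LinearMap.proj ()) F.aug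
    fun k => ⟨fun _ => a k, fun _ => by rw [sub_zero]; exact ha k, haF k⟩
  exact ⟨LinearMap.proj (φ := fun _ : Unit => MvPolynomial σ K) () ∘ₗ h, hF, fun j v hv => by simpa using hh j v hv ()⟩

variable (F : GradedFreeResolution σ (quotientDegreePart I))
  (G : GradedFreeResolution σ (quotientDegreePart J))

/-- The degrees of the basis of the total tensor product. -/
def tensorDeg (c : ℕ) (x : TensorComplex.Index F.ι G.ι c) : ℤ :=
  F.deg x.1.1 x.1.2.2.1 + G.deg x.1.2.1 x.1.2.2.2

theorem comp_col_mem {c : ℕ} {z : ℤ} {w : TensorComplex.Index F.ι G.ι c → MvPolynomial σ K}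
    (hw : w ∈ freeDegreePart (F.tensorDeg G c) z) (i j : ℕ) (h : i + j = c) (l : G.ι j) :
    (fun k => TensorComplex.comp i j h w k l) ∈ freeDegreePart (F.deg i) (z - G.deg j l) := by
  intro k
  have := hw ⟨⟨i, j, k, l⟩, h⟩
  rwa [tensorDeg, add_comm, ← sub_sub] at this

theorem comp_row_mem {c : ℕ} {z : ℤ} {w : TensorComplex.Index F.ι G.ι c → MvPolynomial σ K}
    (hw : w ∈ freeDegreePart (F.tensorDeg G c) z) (i j : ℕ) (h : i + j = c) (k : F.ι i) :
    TensorComplex.comp i j h w k ∈ freeDegreePart (G.deg j) (z - F.deg i k) := by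
  intro l
  have := hw ⟨⟨i, j, k, l⟩, h⟩
  rwa [tensorDeg, ← sub_sub] at this

theorem tensorDiff_apply (c : ℕ) (w : TensorComplex.Index F.ι G.ι (c + 1) → MvPolynomial σ K)
    (x : TensorComplex.Index F.ι G.ι c) :
    TensorComplex.diff F.diff G.diff c w x =
      F.diff x.1.1 (fun k => TensorComplex.comp (x.1.1 + 1) x.1.2.1 (by have := x.2; omega) w k
        x.1.2.2.2) x.1.2.2.1 +
      (-1) ^ x.1.1 * G.diff x.1.2.1 (TensorComplex.comp x.1.1 (x.1.2.1 + 1)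
        (by have := x.2; omega) w x.1.2.2.1) x.1.2.2.2 := rfl

theorem neg_one_pow_mul_mem_polyDegreePart {z : ℤ} {p : MvPolynomial σ K} (i : ℕ)
    (hp : p ∈ polyDegreePart σ K z) : (-1) ^ i * p ∈ polyDegreePart σ K z := by
  rcases neg_one_pow_eq_or (MvPolynomial σ K) i with h | h
  · rwa [h, one_mul]
  · rw [h, neg_one_mul]; exact neg_mem hp

theorem t_le_iff {i : ℕ} {b : WithBot ℤ} : F.t i ≤ b ↔ ∀ k, (F.deg i k : WithBot ℤ) ≤ b := by
  simp [t, Finset.sup_le_iff]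

theorem t_add_t_le_iff {i j : ℕ} {b : WithBot ℤ} :
    F.t i + G.t j ≤ b ↔ ∀ k l, ((F.deg i k + G.deg j l : ℤ) : WithBot ℤ) ≤ b := by
  constructor
  · intro h k l
    rw [WithBot.coe_add]
    exact (add_le_add ((F.t_le_iff).1 le_rfl k) ((G.t_le_iff).1 le_rfl l)).trans h
  -- An empty basis makes the sum `-∞`; otherwise both suprema are attained.
  · intro h
    rcases isEmpty_or_nonempty (F.ι i) with hF | hF
    · rw [t, Finset.univ_eq_empty, Finset.sup_empty, WithBot.bot_add]; exact bot_le
    rcases isEmpty_or_nonempty (G.ι j) with hG | hG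
    · rw [t, t, Finset.univ_eq_empty (α := G.ι j), Finset.sup_empty, WithBot.add_bot]
      exact bot_le
    obtain ⟨k, -, hk⟩ := Finset.exists_mem_eq_sup Finset.univ Finset.univ_nonempty
      fun k => (F.deg i k : WithBot ℤ)
    obtain ⟨l, -, hl⟩ := Finset.exists_mem_eq_sup Finset.univ Finset.univ_nonempty
      fun l => (G.deg j l : WithBot ℤ)
    rw [t, t, hk, hl, ← WithBot.coe_add]
    exact h k l

/-- The total tensor product of graded free resolutions of `R ⧸ I` and `R ⧸ J` resolves
`R ⧸ (I + J)` if `I` and `J` are generated by polynomials in disjoint sets of variables. -/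
theorem exists_tensor {A B : Set σ} {S T : Set (MvPolynomial σ K)} (hAB : Disjoint A B)
    (hSA : S ⊆ MvPolynomial.supported K A) (hTB : T ⊆ MvPolynomial.supported K B)
    (hSI : Ideal.span S = I) (hTJ : Ideal.span T = J) :
    ∃ H : GradedFreeResolution σ (quotientDegreePart (I + J)),
      (F.IsMinimal → G.IsMinimal → H.IsMinimal) ∧
      ∀ c b, H.t c ≤ b ↔ ∀ i j, i + j = c → F.t i + G.t j ≤ b := by
  classical
  obtain ⟨α, hα, hαdeg⟩ := F.exists_aug_lift
  obtain ⟨β, hβ, hβdeg⟩ := G.exists_aug_lift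
  obtain ⟨hI₀, hI⟩ := G.exists_sub_diff_mem hAB hSA hTB hSI hTJ
  have hαsurj : ∀ p, ∃ v, α v - p ∈ I := fun p => by
    obtain ⟨v, hv⟩ := F.aug_surjective (Ideal.Quotient.mk I p)
    exact ⟨v, by rw [← Ideal.Quotient.eq, hα, hv]⟩
  have hβsurj : ∀ p, ∃ v, β v - p ∈ J := fun p => by
    obtain ⟨v, hv⟩ := G.aug_surjective (Ideal.Quotient.mk J p)
    exact ⟨v, by rw [← Ideal.Quotient.eq, hβ, hv]⟩
  have hdα : ∀ v, α v ∈ I ↔ v ∈ Set.range (F.diff 0) := fun v => by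
    rw [← Ideal.Quotient.eq_zero_iff_mem, hα, F.exact_zero v]
  have hdβ : ∀ v, β (G.diff 0 v) ∈ J := fun v => by
    rw [← Ideal.Quotient.eq_zero_iff_mem, hβ]; exact G.exact_zero.apply_apply_eq_zero v
  have hG : ∀ i v, G.diff i (G.diff (i + 1) v) = 0 :=
    fun i => (G.exact_succ i).apply_apply_eq_zero
  have hI₀' : ∀ x, β x ∈ I + J → ∃ y, ∀ l, (x - G.diff 0 y) l ∈ I := fun x hx => by
    obtain ⟨p, hp, q, hq, hpq⟩ := Submodule.mem_sup.1 hx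
    refine hI₀ x p hp ?_
    rw [← hβ, ← hpq, map_add, Ideal.Quotient.eq_zero_iff_mem.2 hq, add_zero]
  let H : GradedFreeResolution σ (quotientDegreePart (I + J)) :=
    { ι := TensorComplex.Index F.ι G.ι
      fintype_ι := fun c => Fintype.ofFinite _
      deg := F.tensorDeg G
      length := F.length + G.length
      isEmpty_of_length_lt := fun c hc => ⟨fun ⟨⟨i, j, k, l⟩, h⟩ => by
        replace h : i + j = c := h
        rcases Nat.lt_or_ge F.length i with hi | hi
        · exact (F.isEmpty_of_length_lt i hi).false k
        · exact (G.isEmpty_of_length_lt j (by omega)).false l⟩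
      diff := TensorComplex.diff F.diff G.diff
      aug := Submodule.mkQ (I + J) ∘ₗ TensorComplex.augLift α β
      diff_mem := fun c z w hw x => by
        rw [tensorDiff_apply]
        refine add_mem ?_ (neg_one_pow_mul_mem_polyDegreePart _ ?_)
        · have := F.diff_mem x.1.1 _ _ (F.comp_col_mem G hw (x.1.1 + 1) x.1.2.1
            (by have := x.2; omega) x.1.2.2.2) x.1.2.2.1
          rwa [sub_sub, add_comm] at this
        · have := G.diff_mem x.1.2.1 _ _ (F.comp_row_mem G hw x.1.1 (x.1.2.1 + 1)
            (by have := x.2; omega) x.1.2.2.1) x.1.2.2.2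
          rwa [sub_sub] at this
      aug_mem := fun z w hw => ⟨_, hβdeg z _ fun l => hαdeg _ _ (F.comp_col_mem G hw 0 0 rfl l), rfl⟩
      aug_surjective := fun x => by
        obtain ⟨p, rfl⟩ := Ideal.Quotient.mk_surjective x
        obtain ⟨v, hv⟩ := hβsurj p
        choose u hu using fun l => hαsurj (v l)
        refine ⟨TensorComplex.ofComp fun i j => match i, j with
          | 0, 0 => fun _ k l => u l k
          | 0, _ + 1 => fun _ => 0
          | _ + 1, _ => fun _ => 0, ?_⟩
        change Ideal.Quotient.mk (I + J) (β fun l => α (u l)) = _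
        rw [Ideal.Quotient.eq, ← sub_add_sub_cancel _ (β v), ← map_sub]
        exact Submodule.add_mem_sup (TensorComplex.apply_mem_of_forall_mem β hu) hv
      exact_zero := fun w => by
        rw [← TensorComplex.augLift_mem_iff F.exact_succ hG hαsurj hdα hdβ hI₀' w]
        exact Submodule.Quotient.mk_eq_zero _
      exact_succ := TensorComplex.exact_diff F.exact_succ hG hαsurj hdα hI }
  refine ⟨H, fun hF hG c w x => ?_, fun c b => ?_⟩
  · change TensorComplex.diff F.diff G.diff c w x ∈ _
    rw [tensorDiff_apply]
    exact add_mem (hF _ _ _) (Ideal.mul_mem_left _ _ (hG _ _ _))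
  · simp_rw [t_add_t_le_iff]
    rw [t_le_iff]
    exact ⟨fun h i j hc k l => h ⟨⟨i, j, k, l⟩, hc⟩,
      fun h ⟨⟨i, j, k, l⟩, hc⟩ => h i j hc k l⟩

variable {F G}

theorem Subadditive.tensor {H : GradedFreeResolution σ (quotientDegreePart (I + J))}
    (hH : ∀ c b, H.t c ≤ b ↔ ∀ i j, i + j = c → F.t i + G.t j ≤ b) (hF : F.Subadditive)
    (hG : G.Subadditive) (a b : ℕ) : H.t (a + b) ≤ H.t a + H.t b := by
  rw [hH]
  intro i j hij
  have key : ∀ i₁ i₂ j₁ j₂, i₁ + i₂ = i → j₁ + j₂ = j → i₁ + j₁ = a → i₂ + j₂ = b →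
      F.t i + G.t j ≤ H.t a + H.t b := by
    rintro i₁ i₂ j₁ j₂ rfl rfl h₁ h₂
    calc F.t (i₁ + i₂) + G.t (j₁ + j₂) ≤ (F.t i₁ + F.t i₂) + (G.t j₁ + G.t j₂) :=
          add_le_add (hF.t_add_le _ _) (hG.t_add_le _ _)
      _ = (F.t i₁ + G.t j₁) + (F.t i₂ + G.t j₂) := add_add_add_comm _ _ _ _
      _ ≤ H.t a + H.t b :=
          add_le_add ((hH a _).1 le_rfl _ _ h₁) ((hH b _).1 le_rfl _ _ h₂)
  -- Take `i₁ = min i a`; the other three parts are then determined.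
  rcases le_total i a with h | h
  · exact key i 0 (a - i) b (by omega) (by omega) (by omega) (by omega)
  · exact key a (i - a) 0 j (by omega) (by omega) (by omega) (by omega)

end GradedFreeResolution

theorem mainTheorem8 {K : Type*} [Field K] {n : ℕ} (I J : Ideal (MvPolynomial (Fin n) K))
    (hI : I.IsHomogeneous (MvPolynomial.homogeneousSubmodule (Fin n) K))
    (hJ : J.IsHomogeneous (MvPolynomial.homogeneousSubmodule (Fin n) K))
    (hdisj : ∃ (A B : Set (Fin n)) (S T : Set (MvPolynomial (Fin n) K)),
      Disjoint A B ∧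
      S ⊆ MvPolynomial.supported K A ∧ T ⊆ MvPolynomial.supported K B ∧
      Minimal (fun U : Set (MvPolynomial (Fin n) K) => Ideal.span U = I) S ∧
      Minimal (fun U : Set (MvPolynomial (Fin n) K) => Ideal.span U = J) T)
    (hsubI : SubadditivityHolds I) (hsubJ : SubadditivityHolds J) :
    SubadditivityHolds (I + J) := by
  obtain ⟨A, B, S, T, hAB, hSA, hTB, hS, hT⟩ := hdisj
  obtain ⟨⟨F, hF⟩, hFsub⟩ := hsubI
  obtain ⟨⟨G, hG⟩, hGsub⟩ := hsubJ
  obtain ⟨H, hH, hHt⟩ := F.exists_tensor G hAB hSA hTB hS.prop hT.prop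
  exact (hH hF hG).subadditivityHolds (hI.sup hJ)
    ((hFsub F hF).tensor hHt (hGsub G hG))
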